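/- For a slope $s\in(1,2]$ let $T=T_s:[0,1]\to[0,1]$, $T_s(x)=\min\{sx,\,s(1-x)\}$, be the tent map, with critical point $c=\tfrac12$, and write $c_n=T^n(c)$; the interval $[c_2,c_1]$ is the core. Put $D_1=[c,c_1]$ and, for $n\ge 1$, $D_{n+1}=[c_{n+1},c_1]$ if $c\in D_n$ and $D_{n+1}=T(D_n)$ if $c\notin D_n$. An integer $n\ge1$ is a cutting time if $c\in D_n$; the cutting times are numbered increasingly $1=S_0<S_1<S_2<\cdots$. Let $\mathcal A$ be the Barge–Brucks–Diamond set: the set of all $s\in[\sqrt2,2]$ such that for every $a\in[c_2,c]$ and every $\delta>0$ there exist an integer $n\ge1$ and points $c_2<a_s<b_s<c_1$ with $T_s^n(c_2)\in(a-\delta,a+\delta)$, $T_s^n(a_s)=c_2$, $T_s^n(b_s)=c$, and $T_s^n$ monotone on each of the intervals $[c_2,a_s]$ and $[a_s,b_s]$. **Proposition.** For every $s\in(1,2]$, the set $\{c_{S_k}: k\ge 1\}$ is dense in the core $[c_2,c_1]$ if and only if $s\in\mathcal A$. -/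

import Mathlib

namespace TentMap

/-- The tent map `T_s(x) = min {s x, s (1 - x)}` of slope `s`. It is used for `1 < s ≤ 2`, when it
maps `[0, 1]` into itself; all the points occurring below lie in `[0, 1]`. -/
noncomputable def tent (s x : ℝ) : ℝ := min (s * x) (s * (1 - x))

/-- The critical point `c = 1/2`. -/
noncomputable def crit : ℝ := 1 / 2

/-- The critical orbit `c_n = T_s^n(c)`. -/
noncomputable def critOrbit (s : ℝ) (n : ℕ) : ℝ := (tent s)^[n] crit

/-- The core `[c_2, c_1]`. -/
def core (s : ℝ) : Set ℝ := Set.Icc (critOrbit s 2) (critOrbit s 1)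

open Classical in
/-- The intervals of the Hofbauer tower: `D_1 = [c, c_1]`, and `D_{n+1}` is `[c_{n+1}, c_1]` if
`c ∈ D_n` and `T_s(D_n)` otherwise, for `n ≥ 1`. (The index `0` is not used; `D_0` is set to `∅`,
so that `0` is not a cutting time.) -/
noncomputable def hofbauer (s : ℝ) : ℕ → Set ℝ
  | 0 => ∅
  | 1 => Set.Icc crit (critOrbit s 1)
  | n + 2 =>
    if crit ∈ hofbauer s (n + 1) then Set.Icc (critOrbit s (n + 2)) (critOrbit s 1)
    else tent s '' hofbauer s (n + 1)

/-- `n` is a cutting time if `c ∈ D_n`. -/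
def IsCuttingTime (s : ℝ) (n : ℕ) : Prop := crit ∈ hofbauer s n

/-- The increasing enumeration `S_0 = 1 < S_1 = 2 < S_2 < ⋯` of the cutting times. -/
noncomputable def cuttingTime (s : ℝ) (k : ℕ) : ℕ := Nat.nth (IsCuttingTime s) k

/-- `f` is monotone (nondecreasing or nonincreasing) on the set `J`. -/
def IsMonotoneOn (f : ℝ → ℝ) (J : Set ℝ) : Prop := MonotoneOn f J ∨ AntitoneOn f J

/-- The Barge–Brucks–Diamond set `𝒜` of slopes, a subset of the parameter interval `[√2, 2]`:
for all `a ∈ [c_2, c]` and `δ > 0` there are `n ≥ 1` and `c_2 < u < v < c_1` such that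
`T_s^n(c_2) ∈ (a - δ, a + δ)`, `T_s^n(u) = c_2`, `T_s^n(v) = c`, and `T_s^n` is monotone on
`[c_2, u]` and on `[u, v]`. -/
def bargeBrucksDiamond : Set ℝ :=
  {s | s ∈ Set.Icc (Real.sqrt 2) 2 ∧
    ∀ a ∈ Set.Icc (critOrbit s 2) crit, ∀ δ : ℝ, 0 < δ →
      ∃ n : ℕ, 1 ≤ n ∧ ∃ u v : ℝ,
        critOrbit s 2 < u ∧ u < v ∧ v < critOrbit s 1 ∧
        (tent s)^[n] (critOrbit s 2) ∈ Set.Ioo (a - δ) (a + δ) ∧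
        (tent s)^[n] u = critOrbit s 2 ∧
        (tent s)^[n] v = crit ∧
        IsMonotoneOn (tent s)^[n] (Set.Icc (critOrbit s 2) u) ∧
        IsMonotoneOn (tent s)^[n] (Set.Icc u v)}

end TentMap

namespace TentMap

open Set Filter Topology

/-! By `exists_hofbauer_eq_image`, `n + 2` is a cutting time as soon as `T^n` is injective on some
`[c_2, u]` in the core and sends `u` to `c`, provided `c` is not periodic; conversely every cutting
time `n + 2` yields such a `u`. Both conditions therefore concern monotone branches of iterates
starting at `c_2`.

Density gives the condition: below `√2` the critical orbit avoids a gap of the core. Otherwise take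
`c_n`, `n` a cutting time, just right of `c`, with `c_{n+2}` also there and `c_{n+4}` near `a`; the
branch ending at `c` then unfolds under `T^4` into the required two-piece branch.

Conversely, the condition gives branches from `c_{n+2}`, near any chosen point of `[c_2, c]`, down
to `c_2`. Composing with an injective branch of `T^M` that takes the value `c` produces cutting
times (`iterate_mem_closure_cuttingOrbit`); `exists_inverse_branch` supplies enough such branches to
reach the whole core. -/

/-! ### Elementary properties of the tent map -/

lemma continuous_tent (s : ℝ) : Continuous (tent s) := by
  unfold tent; fun_prop

lemma continuous_tent_iterate (s : ℝ) (n : ℕ) : Continuous (tent s)^[n] :=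
  (continuous_tent s).iterate n

lemma tent_of_le {s x : ℝ} (hs : 0 < s) (hx : x ≤ 1 / 2) : tent s x = s * x := by
  unfold tent; exact min_eq_left (by nlinarith)

lemma tent_of_ge {s x : ℝ} (hs : 0 < s) (hx : 1 / 2 ≤ x) : tent s x = s * (1 - x) := by
  unfold tent; exact min_eq_right (by nlinarith)

lemma tent_one_sub (s x : ℝ) : tent s (1 - x) = tent s x := by
  unfold tent; rw [min_comm]; ring_nf

lemma critOrbit_one {s : ℝ} (hs : 0 < s) : critOrbit s 1 = s / 2 := by
  simp only [critOrbit, crit, Function.iterate_one]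
  rw [tent_of_le hs le_rfl]; ring

lemma critOrbit_succ (s : ℝ) (n : ℕ) : critOrbit s (n + 1) = tent s (critOrbit s n) :=
  Function.iterate_succ_apply' _ _ _

lemma critOrbit_two {s : ℝ} (hs : 1 < s) : critOrbit s 2 = s - s ^ 2 / 2 := by
  rw [critOrbit_succ, critOrbit_one (by linarith), tent_of_ge (by linarith) (by linarith)]; ring

lemma critOrbit_add (s : ℝ) (n k : ℕ) : critOrbit s (n + k) = (tent s)^[n] (critOrbit s k) :=
  Function.iterate_add_apply _ _ _ _

lemma critOrbit_two_lt_crit {s : ℝ} (hs : 1 < s) : critOrbit s 2 < crit := by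
  rw [critOrbit_two hs, crit]; nlinarith [mul_pos (sub_pos.2 hs) (sub_pos.2 hs)]

lemma crit_lt_critOrbit_one {s : ℝ} (hs : 1 < s) : crit < critOrbit s 1 := by
  rw [critOrbit_one (by linarith), crit]; linarith

lemma injOn_tent_Iic {s : ℝ} (hs : 0 < s) : InjOn (tent s) (Iic crit) := by
  intro x hx y hy h
  rw [tent_of_le hs hx, tent_of_le hs hy] at h
  exact mul_left_cancel₀ hs.ne' h

lemma injOn_tent_Ici {s : ℝ} (hs : 0 < s) : InjOn (tent s) (Ici crit) := by
  intro x hx y hy h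
  rw [tent_of_ge hs hx, tent_of_ge hs hy] at h
  linarith [mul_left_cancel₀ hs.ne' h]

lemma injOn_tent_uIcc_crit {s : ℝ} (hs : 0 < s) (x : ℝ) : InjOn (tent s) (uIcc x crit) := by
  rcases le_total x crit with h | h
  · exact (injOn_tent_Iic hs).mono (by rw [uIcc_of_le h]; exact fun y hy => hy.2)
  · exact (injOn_tent_Ici hs).mono (by rw [uIcc_of_ge h]; exact fun y hy => hy.1)

/-- The image of a compact interval under an injective continuous function. -/
lemma image_Icc_of_injOn {f : ℝ → ℝ} (hf : Continuous f) {a b : ℝ} (hab : a ≤ b)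
    (hi : InjOn f (Icc a b)) : f '' Icc a b = uIcc (f a) (f b) := by
  apply Subset.antisymm
  · rw [← uIcc_of_le hab] at hi ⊢
    rcases hf.continuousOn.strictMonoOn_of_injOn_Icc' hab (by rwa [uIcc_of_le hab] at hi)
      with h | h
    · rw [← uIcc_of_le hab] at h
      exact h.monotoneOn.image_uIcc_subset
    · rw [← uIcc_of_le hab] at h
      exact h.antitoneOn.image_uIcc_subset
  · have := intermediate_value_uIcc (a := a) (b := b) hf.continuousOn
    rwa [uIcc_of_le hab] at this

lemma image_tent_uIcc_crit {s : ℝ} (hs : 0 < s) (x : ℝ) :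
    tent s '' uIcc x crit = Icc (tent s x) (critOrbit s 1) := by
  have h1 : tent s x ≤ critOrbit s 1 := by
    rw [critOrbit_one hs]
    rcases le_total x (1 / 2) with h | h
    · rw [tent_of_le hs h]; nlinarith
    · rw [tent_of_ge hs h]; nlinarith
  have h2 : tent s crit = critOrbit s 1 := (critOrbit_succ s 0).symm
  rcases le_total x crit with h | h
  · rw [uIcc_of_le h, image_Icc_of_injOn (continuous_tent s) h, h2, uIcc_of_le h1]
    exact uIcc_of_le h ▸ injOn_tent_uIcc_crit hs x
  · rw [uIcc_of_ge h, image_Icc_of_injOn (continuous_tent s) h, h2, uIcc_of_ge h1]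
    exact uIcc_of_ge h ▸ injOn_tent_uIcc_crit hs x

lemma finite_preimage_tent_iterate {s : ℝ} (hs : 0 < s) (n : ℕ) (y : ℝ) :
    ((tent s)^[n] ⁻¹' {y}).Finite := by
  induction n generalizing y with
  | zero => simp
  | succ n ih =>
    have h : (tent s)^[n + 1] ⁻¹' {y} ⊆
        ((tent s)^[n] ⁻¹' {y / s}) ∪ ((tent s)^[n] ⁻¹' {1 - y / s}) := by
      intro x hx
      simp only [mem_preimage, mem_singleton_iff, Function.iterate_succ_apply', mem_union] at hx ⊢
      rcases le_total ((tent s)^[n] x) (1 / 2) with h | h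
      · rw [tent_of_le hs h] at hx
        left; field_simp; linarith
      · rw [tent_of_ge hs h] at hx
        right; field_simp; linarith
    exact ((ih _).union (ih _)).subset h

/-- Fibres of `T^n` are finite, so a weakly monotone branch cannot be constant on an interval. -/
lemma injOn_of_isMonotoneOn {s : ℝ} (hs : 0 < s) {n : ℕ} {a b : ℝ}
    (h : IsMonotoneOn (tent s)^[n] (Icc a b)) : InjOn (tent s)^[n] (Icc a b) := by
  have key : ∀ x ∈ Icc a b, ∀ y ∈ Icc a b, x < y → (tent s)^[n] x ≠ (tent s)^[n] y := by
    intro x hx y hy hxy he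
    have hsub : Icc x y ⊆ (tent s)^[n] ⁻¹' {(tent s)^[n] x} := by
      intro t ht
      have ht' : t ∈ Icc a b := ⟨hx.1.trans ht.1, ht.2.trans hy.2⟩
      rcases h with h | h
      · exact le_antisymm (he ▸ h ht' hy ht.2) (h hx ht' ht.1)
      · exact le_antisymm (h hx ht' ht.1) (he ▸ h ht' hy ht.2)
    exact (Icc_infinite hxy) ((finite_preimage_tent_iterate hs n _).subset hsub)
  intro x hx y hy he
  rcases lt_trichotomy x y with h1 | h1 | h1
  · exact absurd he (key x hx y hy h1)
  · exact h1
  · exact absurd he.symm (key y hy x hx h1)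

/-- `T` is not injective on an interval having `c` in its interior. -/
lemma not_injOn_tent_uIcc {s x y : ℝ} (h : crit ∈ uIcc x y) (hx : x ≠ crit)
    (hy : y ≠ crit) : ¬ InjOn (tent s) (uIcc x y) := by
  wlog hxy : x ≤ y generalizing x y
  · rw [uIcc_comm] at h ⊢
    exact this h hy hx (le_of_not_ge hxy)
  rw [uIcc_of_le hxy] at h ⊢
  intro hi
  have h1 : x < crit := lt_of_le_of_ne h.1 hx
  have h2 : crit < y := lt_of_le_of_ne h.2 hy.symm
  obtain ⟨e, he0, he⟩ := exists_between (lt_min (sub_pos.2 h1) (sub_pos.2 h2))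
  have he1 := he.trans_le (min_le_left _ _)
  have he2 := he.trans_le (min_le_right _ _)
  have h3 : tent s (crit - e) = tent s (crit + e) := by
    rw [← tent_one_sub]; congr 1; unfold crit; ring
  have := hi ⟨by linarith, by linarith⟩ ⟨by linarith, by linarith⟩ h3
  linarith

/-! ### Hofbauer tower and monotone branches at `c_2` -/

lemma hofbauer_succ_succ_of_mem {s : ℝ} {n : ℕ} (h : crit ∈ hofbauer s (n + 1)) :
    hofbauer s (n + 2) = Icc (critOrbit s (n + 2)) (critOrbit s 1) := by
  rw [hofbauer, if_pos h]

lemma hofbauer_succ_succ_of_notMem {s : ℝ} {n : ℕ} (h : crit ∉ hofbauer s (n + 1)) :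
    hofbauer s (n + 2) = tent s '' hofbauer s (n + 1) := by
  rw [hofbauer, if_neg h]

lemma isCuttingTime_one {s : ℝ} (hs : 1 < s) : IsCuttingTime s 1 := by
  rw [IsCuttingTime, hofbauer]
  exact ⟨le_rfl, (crit_lt_critOrbit_one hs).le⟩

/-- `D_{n+2}` is the image under `T^n` of an interval `[c_2, z]` on which `T^n` is injective. If `c`
is not periodic, then `[c_2, z]` is the largest such interval inside the core. -/
lemma exists_hofbauer_eq_image {s : ℝ} (hs : 1 < s) (n : ℕ) :
    ∃ z ∈ core s, hofbauer s (n + 2) = (tent s)^[n] '' Icc (critOrbit s 2) z ∧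
      InjOn (tent s)^[n] (Icc (critOrbit s 2) z) ∧
      ((∀ j, 1 ≤ j → critOrbit s j ≠ crit) → ∀ u ∈ core s,
        InjOn (tent s)^[n] (Icc (critOrbit s 2) u) → u ≤ z) := by
  have hs0 : 0 < s := by linarith
  have h21 : critOrbit s 2 ≤ critOrbit s 1 :=
    ((critOrbit_two_lt_crit hs).trans (crit_lt_critOrbit_one hs)).le
  induction n with
  | zero =>
    refine ⟨critOrbit s 1, right_mem_Icc.2 h21, ?_, by simp, fun _ u hu _ => hu.2⟩
    rw [hofbauer_succ_succ_of_mem (isCuttingTime_one hs)]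
    simp
  | succ n ih =>
    obtain ⟨z, hz, hD, hinj, hmax⟩ := ih
    have himg := image_Icc_of_injOn (continuous_tent_iterate s n) hz.1 hinj
    have hsucc : (tent s)^[n + 1] = tent s ∘ (tent s)^[n] := Function.iterate_succ' _ _
    by_cases hc : crit ∈ hofbauer s (n + 2)
    -- Cut the branch at the preimage `w` of `c`: the part kept has image spanned by `c_{n+2}` and
    -- `c`, which `T` folds onto `[c_{n+3}, c_1]`.
    · have hc' := hc
      rw [hD] at hc'
      obtain ⟨w, hw, hwc⟩ := hc'
      have hsub : Icc (critOrbit s 2) w ⊆ Icc (critOrbit s 2) z := Icc_subset_Icc_right hw.2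
      have himgw := image_Icc_of_injOn (continuous_tent_iterate s n) hw.1 (hinj.mono hsub)
      rw [hwc] at himgw
      refine ⟨w, ⟨hw.1, hw.2.trans hz.2⟩, ?_, ?_, ?_⟩
      · rw [hofbauer_succ_succ_of_mem hc, hsucc, image_comp, himgw, image_tent_uIcc_crit hs0,
          ← critOrbit_add, ← critOrbit_succ]
      · rw [hsucc]
        have := injOn_tent_uIcc_crit hs0 ((tent s)^[n] (critOrbit s 2))
        rw [← himgw] at this
        exact this.comp (hinj.mono hsub) (mapsTo_image _ _)
      · intro hper u hu hui
        -- Past `w`, the image would contain `c` strictly between `c_{n+2}` and `T^n u`, where `T`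
        -- folds.
        by_contra! hwu
        rw [hsucc] at hui
        have hui' : InjOn (tent s)^[n] (Icc (critOrbit s 2) u) := InjOn.of_comp hui
        have himgu := image_Icc_of_injOn (continuous_tent_iterate s n) hu.1 hui'
        refine not_injOn_tent_uIcc (s := s) (x := (tent s)^[n] (critOrbit s 2))
          (y := (tent s)^[n] u) ?_ ?_ ?_ ?_
        · rw [← himgu, ← hwc]; exact mem_image_of_mem _ ⟨hw.1, hwu.le⟩
        · rw [← critOrbit_add]; exact hper _ (by omega)
        · rw [← hwc]
          intro h
          exact hwu.ne' (hui' ⟨hu.1, le_rfl⟩ ⟨hw.1, hwu.le⟩ h)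
        · rw [← himgu]; exact hui.image_of_comp
    · refine ⟨z, hz, ?_, ?_, ?_⟩
      · rw [hofbauer_succ_succ_of_notMem hc, hD, hsucc, image_comp]
      · rw [hsucc]
        have hinjT : InjOn (tent s) ((tent s)^[n] '' Icc (critOrbit s 2) z) := by
          rw [← hD] at himg ⊢
          rw [himg] at hc ⊢
          rcases lt_or_ge crit (min ((tent s)^[n] (critOrbit s 2)) ((tent s)^[n] z)) with h | h
          · exact (injOn_tent_Ici hs0).mono fun y hy => h.le.trans hy.1
          · refine (injOn_tent_Iic hs0).mono fun y hy => ?_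
            by_contra hy'
            exact hc ⟨h, (le_of_not_ge hy').trans hy.2⟩
        exact hinjT.comp hinj (mapsTo_image _ _)
      · intro hper u hu hui
        rw [hsucc] at hui
        exact hmax hper u hu (InjOn.of_comp hui)

/-- The points `c_{S_k}`, `k ≥ 1`. -/
def cuttingOrbit (s : ℝ) : Set ℝ :=
  {x : ℝ | ∃ k : ℕ, 1 ≤ k ∧ x = critOrbit s (cuttingTime s k)}

lemma critOrbit_mem_cuttingOrbit {s : ℝ} (hs : 1 < s) {n : ℕ} (hn : 2 ≤ n)
    (h : IsCuttingTime s n) : critOrbit s n ∈ cuttingOrbit s := by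
  classical
  refine ⟨Nat.count (IsCuttingTime s) n, ?_, ?_⟩
  · have := Nat.count_strict_mono (isCuttingTime_one hs) (show 1 < n by omega)
    omega
  · rw [cuttingTime, Nat.nth_count h]

/-- If there were only finitely many cutting times, `Nat.nth` would return the default `0`,
contributing the spurious point `c_0 = c`; hence `c` is excluded. -/
lemma exists_isCuttingTime_of_mem_cuttingOrbit {s x : ℝ} (hx : x ∈ cuttingOrbit s)
    (hxc : x ≠ crit) : ∃ n, IsCuttingTime s n ∧ x = critOrbit s n := by
  obtain ⟨k, -, rfl⟩ := hx
  refine ⟨cuttingTime s k, ?_, rfl⟩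
  apply Nat.nth_mem_of_ne_zero
  intro h0
  apply hxc
  change critOrbit s (Nat.nth (IsCuttingTime s) k) = crit
  rw [h0]
  rfl

/-! ### Density implies that the slope is at least `√2` -/

/-- For `s² < 2` the intervals `[c_2, c_4]` and `[c_3, c_1]` are disjoint and `T` maps each into the
other, so no `c_n` with `n ≥ 1` lies in the gap `(c_4, c_3)`. -/
lemma two_le_sq_of_core_subset_closure {s : ℝ} (hs : 1 < s)
    (h : core s ⊆ closure (cuttingOrbit s)) : 2 ≤ s ^ 2 := by
  by_contra! hlt
  have hs0 : 0 < s := by linarith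
  have hc1 := critOrbit_one hs0
  have hc2 := critOrbit_two hs
  set c₃ : ℝ := s ^ 2 - s ^ 3 / 2 with hc₃
  set c₄ : ℝ := s * (1 - c₃) with hc₄
  -- The fixed point `s / (1 + s)` lies to the left of `c_3`.
  have hpc3 : s < c₃ * (1 + s) := by
    have : 0 < s * ((2 - s ^ 2) * (s - 1)) :=
      mul_pos hs0 (mul_pos (by linarith) (by linarith))
    rw [hc₃]; nlinarith
  have hc3 : 1 / 2 ≤ c₃ := by nlinarith
  have hc43 : c₄ < c₃ := by rw [hc₄]; nlinarith
  have h42 : c₄ ≤ 1 - (s - s ^ 2 / 2) := by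
    have : 0 < (s - 1) * (c₃ * (1 + s) - s) := mul_pos (by linarith) (by linarith)
    have h3 : s * (s - s ^ 2 / 2) = c₃ := by rw [hc₃]; ring
    rw [hc₄]
    by_contra! hcon
    nlinarith [mul_lt_mul_of_pos_left hcon hs0]
  have h31 : c₃ ≤ s / 2 := by
    rw [hc₃]; nlinarith [mul_nonneg hs0.le (sq_nonneg (s - 1))]
  have hinv : ∀ n, critOrbit s (n + 1) ∈ Icc (s - s ^ 2 / 2) c₄ ∪ Icc c₃ (s / 2) := by
    intro n
    induction n with
    | zero => rw [hc1]; exact Or.inr ⟨h31, le_rfl⟩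
    | succ n ih =>
      rw [critOrbit_succ]
      set x := critOrbit s (n + 1)
      rcases ih with ⟨h1, h2⟩ | ⟨h1, h2⟩
      · right
        rcases le_total x (1 / 2) with hx | hx
        · rw [tent_of_le hs0 hx]
          constructor <;> rw [hc₃] at * <;> nlinarith
        · rw [tent_of_ge hs0 hx]
          constructor
          · have : s * (s - s ^ 2 / 2) = c₃ := by rw [hc₃]; ring
            rw [← this]
            exact mul_le_mul_of_nonneg_left (by linarith) hs0.le
          · nlinarith
      · left
        rw [tent_of_ge hs0 (hc3.trans h1)]
        constructor
        · nlinarith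
        · exact mul_le_mul_of_nonneg_left (by linarith) hs0.le
  have hc24 : s - s ^ 2 / 2 ≤ c₄ := by rw [hc₄]; nlinarith
  have hc3' : 1 / 2 < c₃ := by nlinarith
  -- Staying right of `c` inside the gap rules out the default point `c_0`.
  have hm : max c₄ (1 / 2) < c₃ := max_lt hc43 hc3'
  obtain ⟨q, hq1, hq2⟩ := exists_between hm
  have hq4 := (le_max_left _ _).trans_lt hq1
  obtain ⟨x, hx, hxS⟩ := mem_closure_iff.1 (h ⟨by rw [hc2]; linarith, by rw [hc1]; linarith⟩)
    _ isOpen_Ioo (⟨hq1, hq2⟩ : q ∈ Ioo _ _)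
  have hx4 := (le_max_left _ _).trans_lt hx.1
  have hxc := (le_max_right _ _).trans_lt hx.1
  obtain ⟨n, -, rfl⟩ := exists_isCuttingTime_of_mem_cuttingOrbit hxS hxc.ne'
  rcases n with _ | n
  · exact hxc.ne rfl
  · rcases hinv n with h' | h'
    · exact hx4.not_ge h'.2
    · exact hx.2.not_ge h'.1

/-! ### Density implies the Barge–Brucks–Diamond condition -/

/-- `T²` is affine and monotone on either side of `c`, and maps each of these two intervals onto the
core. -/
lemma tent_tent_of_abs_le {s x : ℝ} (hs : 1 < s) (hx : s * |x - crit| ≤ (s - 1) / 2) :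
    tent s (tent s x) = critOrbit s 2 + s ^ 2 * |x - crit| := by
  have hs0 : 0 < s := by linarith
  rw [critOrbit_two hs]
  unfold crit at *
  rcases le_total x (1 / 2) with h | h
  · rw [abs_of_nonpos (by linarith)] at *
    rw [tent_of_le hs0 h, tent_of_ge hs0 (by linarith)]; ring
  · rw [abs_of_nonneg (by linarith)] at *
    rw [tent_of_ge hs0 h, tent_of_ge hs0 (by linarith)]; ring

lemma mem_bargeBrucksDiamond_of_core_subset_closure {s : ℝ} (hs : 1 < s) (hs2 : s ≤ 2)
    (h : core s ⊆ closure (cuttingOrbit s)) : s ∈ bargeBrucksDiamond := by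
  have hs0 : 0 < s := by linarith
  refine ⟨⟨Real.sqrt_le_iff.2 ⟨hs0.le, two_le_sq_of_core_subset_closure hs h⟩, hs2⟩, ?_⟩
  intro a ha δ hδ
  have hc2c := critOrbit_two_lt_crit hs
  have hcc1 := crit_lt_critOrbit_one hs
  have hc1 := critOrbit_one hs0
  have hc2 := critOrbit_two hs
  have hc : crit = 1 / 2 := rfl
  have hTTc : tent s (tent s crit) = critOrbit s 2 := rfl
  have hsq : 1 < s ^ 2 := by nlinarith
  -- The bound says that `x` is within `(s - 1) / (2 * s)` of `c`, the distance from `c` to its two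
  -- preimages.
  have hright : ∀ x, crit ≤ x → s * (x - crit) ≤ (s - 1) / 2 →
      tent s (tent s x) = critOrbit s 2 + s ^ 2 * (x - crit) := by
    intro x hx hx'
    have := tent_tent_of_abs_le (x := x) hs (by rwa [abs_of_nonneg (by linarith)])
    rwa [abs_of_nonneg (by linarith)] at this
  have hleft : ∀ x, x ≤ crit → s * (crit - x) ≤ (s - 1) / 2 →
      tent s (tent s x) = critOrbit s 2 + s ^ 2 * (crit - x) := by
    intro x hx hx'
    have := tent_tent_of_abs_le (x := x) hs (by rwa [abs_of_nonpos (by linarith), neg_sub])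
    rwa [abs_of_nonpos (by linarith), neg_sub] at this
  obtain ⟨b, hbδ, hb⟩ : ∃ b ∈ Ioo (a - δ) (a + δ), b ∈ Ioo (critOrbit s 2) crit := by
    have : a ∈ closure (Ioo (critOrbit s 2) crit) := by rwa [closure_Ioo hc2c.ne]
    exact mem_closure_iff.1 this _ isOpen_Ioo ⟨by linarith, by linarith⟩
  -- the pull-backs of `b` under the right-hand branch of `T²`
  set e : ℝ := (s - 1) / (2 * s) with he
  have hse : s * e = (s - 1) / 2 := by rw [he]; field_simp
  have he0 : 0 < e := by rw [he]; exact div_pos (by linarith) (by linarith)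
  have hpull : ∀ y, critOrbit s 2 < y → y < critOrbit s 1 →
      ∃ x ∈ Ioo crit (crit + e), tent s (tent s x) = y := by
    intro y hy1 hy2
    have h1 : (y - critOrbit s 2) / s ^ 2 < e := by
      rw [div_lt_iff₀ (by positivity), show e * s ^ 2 = s * (s * e) by ring, hse]
      rw [hc1] at hy2; rw [hc2]; linarith
    have h0 : 0 < (y - critOrbit s 2) / s ^ 2 := div_pos (by linarith) (by positivity)
    refine ⟨crit + (y - critOrbit s 2) / s ^ 2, ⟨by linarith, by linarith⟩, ?_⟩
    rw [hright _ (by linarith) (by nlinarith)]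
    field_simp; ring
  have hce1 : crit + e ≤ critOrbit s 1 := by rw [hc, hc1]; nlinarith
  obtain ⟨b₁, hb₁, hb₁T⟩ := hpull b hb.1 (hb.2.trans hcc1)
  obtain ⟨b₂, hb₂, hb₂T⟩ := hpull b₁ (hc2c.trans hb₁.1) (hb₁.2.trans_le hce1)
  have hcont : Continuous fun x => tent s (tent s x) :=
    (continuous_tent s).comp (continuous_tent s)
  -- This picks `x = c_n` such that `x` and `T² x` lie on the right-hand branch and `T⁴ x` is near
  -- `a`.
  obtain ⟨x, ⟨⟨hx0, hx1⟩, hx2⟩, hxS⟩ := mem_closure_iff.1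
    (h ⟨(hc2c.trans hb₂.1).le, (hb₂.2.trans_le hce1).le⟩)
    (Ioo crit (crit + e) ∩ (fun x => tent s (tent s x)) ⁻¹' (Ioo crit (crit + e)) ∩
      (fun x => tent s (tent s (tent s (tent s x)))) ⁻¹' (Ioo (a - δ) (a + δ)))
    ((isOpen_Ioo.inter (isOpen_Ioo.preimage hcont)).inter
      (isOpen_Ioo.preimage (hcont.comp hcont)))
    ⟨⟨hb₂, by rw [mem_preimage, hb₂T]; exact hb₁⟩, by rw [mem_preimage, hb₂T, hb₁T]; exact hbδ⟩
  rw [mem_preimage] at hx1 hx2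
  obtain ⟨n, hn, rfl⟩ := exists_isCuttingTime_of_mem_cuttingOrbit hxS hx0.1.ne'
  obtain ⟨m, rfl⟩ : ∃ m, n = m + 2 := by
    rcases n with _ | _ | m
    · exact absurd hx0.1 (lt_irrefl _)
    · exact absurd (hx0.2.trans_le hce1) (lt_irrefl _)
    · exact ⟨m, rfl⟩
  obtain ⟨z, hz, hD, hinj, -⟩ := exists_hofbauer_eq_image hs m
  rw [IsCuttingTime, hD] at hn
  obtain ⟨z', hz', hz'c⟩ := hn
  have hinj' := hinj.mono (Icc_subset_Icc_right hz'.2)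
  have himg := image_Icc_of_injOn (continuous_tent_iterate s m) hz'.1 hinj'
  rw [hz'c, ← critOrbit_add, uIcc_of_ge hx0.1.le] at himg
  set f := (tent s)^[m + 2] with hf
  have hfapp : ∀ t, f t = tent s (tent s ((tent s)^[m] t)) := fun t => by
    rw [hf, Function.iterate_succ_apply', Function.iterate_succ_apply']
  have hfcont : Continuous f := continuous_tent_iterate s _
  have hfinj : InjOn f (Icc (critOrbit s 2) z') := by
    have h2 : InjOn (fun t => tent s (tent s t)) (Icc crit (critOrbit s (m + 2))) := by
      intro t ht t' ht' htt'
      simp only at htt'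
      rw [hright t ht.1 (by nlinarith [ht.2, hx0.2]),
        hright t' ht'.1 (by nlinarith [ht'.2, hx0.2])] at htt'
      have := mul_left_cancel₀ (by positivity) (add_left_cancel htt')
      linarith
    rw [← himg] at h2
    refine (h2.comp hinj' (mapsTo_image _ _)).congr fun t _ => (hfapp t).symm
  have hfl : f (critOrbit s 2) = critOrbit s (m + 4) := (critOrbit_add s (m + 2) 2).symm
  have hfr : f z' = critOrbit s 2 := by rw [hfapp, hz'c]; rfl
  have hc4 : critOrbit s (m + 4) ∈ Ioo crit (crit + e) := by
    rw [critOrbit_succ, critOrbit_succ]; exact hx1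
  have hanti : StrictAntiOn f (Icc (critOrbit s 2) z') := by
    rcases hfcont.continuousOn.strictMonoOn_of_injOn_Icc' hz'.1 hfinj with h' | h'
    · have := h'.monotoneOn (left_mem_Icc.2 hz'.1) (right_mem_Icc.2 hz'.1) hz'.1
      rw [hfl, hfr] at this
      linarith [hc4.1]
    · exact h'
  have hivt := intermediate_value_Icc' hz'.1 hfcont.continuousOn
  rw [hfl, hfr] at hivt
  -- `w` is the preimage of `c` under the left-hand branch of `T²`. As `f` decreases from `c_{m+4} >
  -- c` to `c_2`, it passes `c` at `u` and then `w` at `v`; `T²` folds at `c`.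
  set w : ℝ := crit - (crit - critOrbit s 2) / s ^ 2 with hw
  have hd0 : 0 < (crit - critOrbit s 2) / s ^ 2 := div_pos (by linarith) (by positivity)
  have hd1 : (crit - critOrbit s 2) / s ^ 2 < crit - critOrbit s 2 :=
    div_lt_self (by linarith) hsq
  have hd2 : (crit - critOrbit s 2) / s ^ 2 < e := by
    rw [div_lt_iff₀ (by positivity), show e * s ^ 2 = s * (s * e) by ring, hse, hc2, hc]
    nlinarith
  have hwT : tent s (tent s w) = crit := by
    rw [hleft w (by linarith) (by nlinarith), hw]
    field_simp; ring
  obtain ⟨u, hu, hfu⟩ := hivt ⟨hc2c.le, hc4.1.le⟩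
  obtain ⟨v, hv, hfv⟩ := hivt (show w ∈ Icc _ _ from ⟨by linarith, by linarith [hc4.1]⟩)
  have hcu : critOrbit s 2 < u := by
    refine lt_of_le_of_ne hu.1 fun h' => ?_
    rw [← h', hfl] at hfu
    exact hc4.1.ne' hfu
  have huv : u < v := (hanti.lt_iff_gt hv hu).1 (by rw [hfu, hfv]; linarith)
  have hvz : v < z' := by
    refine lt_of_le_of_ne hv.2 fun h' => ?_
    rw [h', hfr] at hfv
    linarith
  have hfapp2 : ∀ t, (tent s)^[m + 4] t = tent s (tent s (f t)) := fun t => by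
    rw [Function.iterate_succ_apply', Function.iterate_succ_apply']
  refine ⟨m + 4, by omega, u, v, hcu, huv, hvz.trans_le (hz'.2.trans hz.2), ?_, ?_, ?_, ?_, ?_⟩
  · rw [hfapp2, hfapp, ← critOrbit_add]; exact hx2
  · rw [hfapp2, hfu, hTTc]
  · rw [hfapp2, hfv, hwT]
  · right
    have key : ∀ t ∈ Icc (critOrbit s 2) u, t ∈ Icc (critOrbit s 2) z' ∧ crit ≤ f t ∧
        s * (f t - crit) ≤ (s - 1) / 2 := by
      intro t ht
      have ht' : t ∈ Icc (critOrbit s 2) z' := ⟨ht.1, ht.2.trans hu.2⟩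
      refine ⟨ht', hfu ▸ hanti.antitoneOn ht' hu ht.2, ?_⟩
      have := hanti.antitoneOn (left_mem_Icc.2 hz'.1) ht' ht.1
      rw [hfl] at this
      nlinarith [hc4.2]
    intro t ht t' ht' htt'
    obtain ⟨h1, h2, h3⟩ := key t ht
    obtain ⟨h1', h2', h3'⟩ := key t' ht'
    rw [hfapp2, hfapp2, hright _ h2 h3, hright _ h2' h3']
    have := hanti.antitoneOn h1 h1' htt'
    gcongr
  · left
    have key : ∀ t ∈ Icc u v, t ∈ Icc (critOrbit s 2) z' ∧ f t ≤ crit ∧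
        s * (crit - f t) ≤ (s - 1) / 2 := by
      intro t ht
      have ht' : t ∈ Icc (critOrbit s 2) z' := ⟨hu.1.trans ht.1, ht.2.trans hv.2⟩
      refine ⟨ht', hfu ▸ hanti.antitoneOn hu ht' ht.1, ?_⟩
      have := hanti.antitoneOn ht' hv ht.2
      rw [hfv] at this
      nlinarith
    intro t ht t' ht' htt'
    obtain ⟨h1, h2, h3⟩ := key t ht
    obtain ⟨h1', h2', h3'⟩ := key t' ht'
    rw [hfapp2, hfapp2, hleft _ h2 h3, hleft _ h2' h3']
    have := hanti.antitoneOn h1 h1' htt'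
    gcongr

/-! ### The Barge–Brucks–Diamond condition implies density -/

/-- A periodic critical orbit is finite, whereas the condition forces its closure to contain `[c_2,
c]`. -/
lemma critOrbit_ne_crit_of_mem_bargeBrucksDiamond {s : ℝ} (hs : 1 < s)
    (h : s ∈ bargeBrucksDiamond) (j : ℕ) (hj : 1 ≤ j) : critOrbit s j ≠ crit := by
  intro hper
  have hfin : (range (critOrbit s)).Finite := by
    refine ((finite_Iio j).image (critOrbit s)).subset ?_
    rintro _ ⟨n, rfl⟩
    refine ⟨n % j, Nat.mod_lt _ hj, ?_⟩
    exact (Function.IsPeriodicPt.iterate_mod_apply (f := tent s) hper n)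
  refine Icc_infinite (critOrbit_two_lt_crit hs) (hfin.subset fun a ha => ?_)
  rw [← hfin.isClosed.closure_eq, Metric.mem_closure_iff]
  intro δ hδ
  obtain ⟨n, -, -, -, -, -, -, hn, -⟩ := h.2 a ha δ hδ
  refine ⟨_, mem_range_self (n + 2), ?_⟩
  rw [critOrbit_add, dist_comm, Real.dist_eq, abs_lt]
  exact ⟨by linarith [hn.1], by linarith [hn.2]⟩

/-- This compares `c_3` with the fixed point. They coincide only at `s = √2`, where the orbit of
`c_2` stays at the fixed point, right of `c`, and cannot approach `c_2`. -/
lemma critOrbit_three_lt_of_mem_bargeBrucksDiamond {s : ℝ} (hs : 1 < s)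
    (h : s ∈ bargeBrucksDiamond) : s * critOrbit s 2 < s / (1 + s) := by
  have hs0 : 0 < s := by linarith
  have hsq : 2 ≤ s ^ 2 := (Real.sqrt_le_left hs0.le).1 h.1.1
  have hp0 : 0 < 1 + s := by linarith
  rw [lt_div_iff₀ hp0, critOrbit_two hs]
  rcases hsq.lt_or_eq with hlt | heq
  · nlinarith [mul_pos hs0 (mul_pos (sub_pos.2 hlt) (sub_pos.2 hs))]
  · exfalso
    have h2 : critOrbit s 2 = s - 1 := by rw [critOrbit_two hs]; linarith
    have hcs : 1 / 2 < 2 - s := by nlinarith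
    have hfix : ∀ n, (tent s)^[n + 1] (critOrbit s 2) = 2 - s := by
      intro n
      induction n with
      | zero =>
        rw [zero_add, Function.iterate_one, h2, tent_of_le hs0 (by linarith)]; nlinarith
      | succ n ih =>
        rw [Function.iterate_succ_apply', ih, tent_of_ge hs0 hcs.le]; nlinarith
    obtain ⟨n, hn1, -, -, -, -, -, hn, -⟩ := h.2 _ ⟨le_rfl, (critOrbit_two_lt_crit hs).le⟩ _
      (sub_pos.2 (critOrbit_two_lt_crit hs))
    obtain ⟨k, rfl⟩ : ∃ k, n = k + 1 := ⟨n - 1, by omega⟩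
    rw [hfix] at hn
    have := hn.2
    unfold crit at this
    linarith

/-- If some iterate of `T` is injective on `[x, r] ∋ z` and maps `x` to `c`, then the image of `z`
is a limit of points `c_{S_k}`. -/
lemma iterate_mem_closure_cuttingOrbit {s : ℝ} (hs : 1 < s) (h : s ∈ bargeBrucksDiamond)
    {M : ℕ} {x z r : ℝ} (hx : critOrbit s 2 < x) (hxz : x < z) (hzr : z < r) (hz : z ≤ crit)
    (hinj : InjOn (tent s)^[M] (Icc x r)) (hxc : (tent s)^[M] x = crit) :
    (tent s)^[M] z ∈ closure (cuttingOrbit s) := by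
  have hs0 : 0 < s := by linarith
  rw [mem_closure_iff]
  intro U hU hzU
  have hV : Ioo x r ∩ (tent s)^[M] ⁻¹' U ∈ 𝓝 z :=
    ((isOpen_Ioo.inter (hU.preimage (continuous_tent_iterate s M))).mem_nhds ⟨⟨hxz, hzr⟩, hzU⟩)
  obtain ⟨δ, hδ, hsub⟩ := Metric.mem_nhds_iff.1 hV
  rw [Real.ball_eq_Ioo] at hsub
  obtain ⟨n, -, u, v, hu, huv, hv, hn, hfu, -, hmono, -⟩ :=
    h.2 z ⟨(hx.trans hxz).le, hz⟩ δ hδ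
  obtain ⟨⟨hn1, hn2⟩, hnU⟩ := hsub hn
  have hfinj := injOn_of_isMonotoneOn hs0 hmono
  have hcont := continuous_tent_iterate s n
  -- Cutting the branch where it reaches `x` keeps its image `[x, c_{n+2}]` inside `[x, r]`, where
  -- `T^M` is injective.
  obtain ⟨u', hu', hfu'⟩ := intermediate_value_Icc' hu.le hcont.continuousOn
    (show x ∈ Icc _ _ from ⟨hfu.trans_le hx.le, hn1.le⟩)
  have hfinj' := hfinj.mono (Icc_subset_Icc_right hu'.2)
  have himg := image_Icc_of_injOn hcont hu'.1 hfinj'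
  rw [hfu', uIcc_of_ge hn1.le] at himg
  have hcomp : (tent s)^[M + n] = (tent s)^[M] ∘ (tent s)^[n] := Function.iterate_add _ _ _
  have hinjMn : InjOn (tent s)^[M + n] (Icc (critOrbit s 2) u') := by
    rw [hcomp]
    refine InjOn.comp (hinj.mono (Icc_subset_Icc_right hn2.le)) hfinj' ?_
    rw [← himg]; exact mapsTo_image _ _
  obtain ⟨y, -, hD, -, hmax⟩ := exists_hofbauer_eq_image hs (M + n)
  have huy := hmax (critOrbit_ne_crit_of_mem_bargeBrucksDiamond hs h) u'
    ⟨hu'.1, hu'.2.trans (huv.trans hv).le⟩ hinjMn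
  refine ⟨critOrbit s (M + n + 2), ?_, critOrbit_mem_cuttingOrbit hs (by omega) ?_⟩
  · rw [critOrbit_add, hcomp]; exact hnU
  · rw [IsCuttingTime, hD]
    exact ⟨u', ⟨hu'.1, huy⟩, by rw [hcomp, Function.comp_apply, hfu', hxc]⟩

/-- The affine inverse branches of the odd iterates of `T` that pass close to the fixed point
`s / (1 + s)` and end to the left of `c`. -/
lemma exists_inverse_branch {s : ℝ} (hs : 1 < s) (hc3 : s * critOrbit s 2 < s / (1 + s)) :
    ∃ (N : ℕ) (g : ℝ → ℝ), StrictMono g ∧ Continuous g ∧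
      ∀ t ∈ Icc crit (critOrbit s 1), critOrbit s 2 < g t ∧ g t ≤ crit ∧
        (tent s)^[N] (g t) = t := by
  have hs0 : 0 < s := by linarith
  have hc1 := critOrbit_one hs0
  have hc : crit = 1 / 2 := rfl
  set p := s / (1 + s) with hp
  have hpe : p * (1 + s) = s := by rw [hp]; field_simp
  have hp1 : 1 / 2 < p := by nlinarith
  -- `G m` inverts `m` steps along the decreasing lap of `T`, contracting towards its fixed point
  -- `p`.
  let G : ℕ → ℝ → ℝ := fun m t => p + (t - p) / (-s) ^ m
  have hG0 : ∀ t, G 0 t = t := fun t => by simp [G]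
  have hGs : ∀ m t, G (m + 1) t = 1 - G m t / s := by
    intro m t
    simp only [G, pow_succ]
    have : (-s) ^ m ≠ 0 := pow_ne_zero _ (by linarith)
    field_simp
    linear_combination (-s) ^ m * hpe
  have hmem : ∀ m, ∀ t ∈ Icc crit (critOrbit s 1), G m t ∈ Icc crit (critOrbit s 1) := by
    intro m t ht
    induction m with
    | zero => rwa [hG0]
    | succ m ih =>
      rw [hGs, hc, hc1] at *
      have h1 : G m t / s ≤ 1 / 2 := by rw [div_le_iff₀ hs0]; linarith [ih.2]
      have h2 : 1 / 2 / s ≤ G m t / s := by gcongr; exact ih.1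
      have h3 : 1 ≤ s / 2 + 1 / 2 / s := by
        have : s / 2 + 1 / 2 / s - 1 = (s - 1) ^ 2 / (2 * s) := by field_simp; ring
        have h4 : 0 ≤ (s - 1) ^ 2 / (2 * s) := by positivity
        linarith
      exact ⟨by linarith, by linarith⟩
  have hinv : ∀ m, ∀ t ∈ Icc crit (critOrbit s 1), (tent s)^[m] (G m t) = t := by
    intro m t ht
    induction m with
    | zero => exact hG0 t
    | succ m ih =>
      have := (hmem (m + 1) t ht).1
      rw [Function.iterate_succ_apply, tent_of_ge hs0 this, hGs]
      rw [show s * (1 - (1 - G m t / s)) = G m t by field_simp; ring]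
      exact ih
  have hlim : Tendsto (fun j : ℕ => G (2 * j) crit) atTop (𝓝 p) := by
    have h1 : Tendsto (fun j : ℕ => (s ^ 2) ^ j) atTop atTop :=
      tendsto_pow_atTop_atTop_of_one_lt (by nlinarith)
    have h2 := (h1.const_div_atTop (crit - p)).const_add p
    simpa only [G, pow_mul, neg_sq, add_zero] using h2
  -- Even indices preserve orientation; once `G (2 * j) c` exceeds `c_3`, left preimages stay right
  -- of `c_2`.
  obtain ⟨j, hj⟩ := (hlim.eventually (lt_mem_nhds hc3)).exists
  have hmono : StrictMono (G (2 * j)) := by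
    intro t t' htt'
    simp only [G, pow_mul, neg_sq]
    gcongr
  refine ⟨2 * j + 1, fun t => G (2 * j) t / s, ?_, ?_, ?_⟩
  · intro t t' htt'
    exact div_lt_div_of_pos_right (hmono htt') hs0
  · simp only [G]; fun_prop
  · intro t ht
    have h1 := hmono.monotone ht.1
    have h2 : G (2 * j) t / s ≤ 1 / 2 := by
      rw [div_le_iff₀ hs0]; linarith [(hmem (2 * j) t ht).2]
    refine ⟨by rw [lt_div_iff₀ hs0]; linarith, h2, ?_⟩
    rw [Function.iterate_succ_apply, tent_of_le hs0 h2,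
      show s * (G (2 * j) t / s) = G (2 * j) t by field_simp]
    exact hinv _ t ht

/-- The condition only approximates points of `[c_2, c]`, so targets are pulled back there by `g`:
directly for `y > c`, and through the right-hand preimage `1 - y / s` for `y < c`. -/
lemma core_subset_closure_of_mem_bargeBrucksDiamond {s : ℝ} (hs : 1 < s)
    (h : s ∈ bargeBrucksDiamond) : core s ⊆ closure (cuttingOrbit s) := by
  have hs0 : 0 < s := by linarith
  have hc2c := critOrbit_two_lt_crit hs
  have hcc1 := crit_lt_critOrbit_one hs
  have hc : crit = 1 / 2 := rfl
  have hc1 := critOrbit_one hs0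
  have hc2 := critOrbit_two hs
  obtain ⟨N, g, hg, hgc, hgt⟩ :=
    exists_inverse_branch hs (critOrbit_three_lt_of_mem_bargeBrucksDiamond hs h)
  have hsurj : ∀ q ∈ Icc (g crit) (g (critOrbit s 1)), ∃ t ∈ Icc crit (critOrbit s 1), g t = q :=
    fun q hq => intermediate_value_Icc hcc1.le hgc.continuousOn hq
  have hinj : InjOn (tent s)^[N] (Icc (g crit) (g (critOrbit s 1))) := by
    intro q hq q' hq' hqq'
    obtain ⟨t, ht, rfl⟩ := hsurj q hq
    obtain ⟨t', ht', rfl⟩ := hsurj q' hq'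
    rw [(hgt t ht).2.2, (hgt t' ht').2.2] at hqq'
    rw [hqq']
  have hinj' : InjOn (tent s)^[N + 1] (Icc (g crit) (g (critOrbit s 1))) := by
    rw [Function.iterate_succ']
    refine (injOn_tent_Ici hs0).comp hinj ?_
    intro q hq
    obtain ⟨t, ht, rfl⟩ := hsurj q hq
    rw [(hgt t ht).2.2]
    exact ht.1
  have hupper : Ioo crit (critOrbit s 1) ⊆ closure (cuttingOrbit s) := by
    intro y hy
    have hcm := hgt crit ⟨le_rfl, hcc1.le⟩
    have hym := hgt y ⟨hy.1.le, hy.2.le⟩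
    have := iterate_mem_closure_cuttingOrbit hs h hcm.1 (hg hy.1) (hg hy.2) hym.2.1 hinj hcm.2.2
    rwa [hym.2.2] at this
  have hlower : Ioo (critOrbit s 2) crit ⊆ closure (cuttingOrbit s) := by
    intro y hy
    have h0 : crit ≤ 1 - crit / s := by
      rw [hc]
      have : 1 / 2 / s ≤ 1 / 2 := div_le_self (by norm_num) hs.le
      linarith
    have h1 : 1 - crit / s < 1 - y / s := by
      have := div_lt_div_of_pos_right hy.2 hs0
      linarith
    have h2 : 1 - y / s < critOrbit s 1 := by
      have h3 := div_lt_div_of_pos_right hy.1 hs0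
      have h4 : critOrbit s 2 / s = 1 - s / 2 := by rw [hc2]; field_simp
      rw [hc1]; linarith
    have hxm := hgt (1 - crit / s) ⟨h0, (h1.trans h2).le⟩
    have hym := hgt (1 - y / s) ⟨(h0.trans_lt h1).le, h2.le⟩
    have hT : ∀ t, crit ≤ 1 - t / s → tent s (1 - t / s) = t := by
      intro t ht
      rw [tent_of_ge hs0 ht]; field_simp; ring
    have := iterate_mem_closure_cuttingOrbit (M := N + 1) hs h hxm.1 (hg h1) (hg h2) hym.2.1
      (hinj'.mono (Icc_subset_Icc_left (hg.monotone h0)))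
      (by rw [Function.iterate_succ_apply', hxm.2.2, hT _ h0])
    rwa [Function.iterate_succ_apply', hym.2.2, hT _ (h0.trans_lt h1).le] at this
  intro y hy
  rcases le_total y crit with hyc | hyc
  · have := closure_minimal hlower isClosed_closure
    rw [closure_Ioo hc2c.ne] at this
    exact this ⟨hy.1, hyc⟩
  · have := closure_minimal hupper isClosed_closure
    rw [closure_Ioo hcc1.ne] at this
    exact this ⟨hyc, hy.2⟩

end TentMap

theorem propositionA2 (s : ℝ) (hs1 : 1 < s) (hs2 : s ≤ 2) :
    TentMap.core s ⊆
        closure {x : ℝ | ∃ k : ℕ, 1 ≤ k ∧ x = TentMap.critOrbit s (TentMap.cuttingTime s k)} ↔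
      s ∈ TentMap.bargeBrucksDiamond :=
  ⟨TentMap.mem_bargeBrucksDiamond_of_core_subset_closure hs1 hs2,
    TentMap.core_subset_closure_of_mem_bargeBrucksDiamond hs1⟩
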